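/- Let $n\ge 2$ and $m\ge 3$ be integers, and let $K$ be a field containing a primitive $m$-th root of unity $q$. Let $U_n(K)=\{\omega\in K : \omega^n=1\}$ be the cyclic group of $n$-th roots of unity in $K$ and $\nu(n)=|U_n(K)|$ its order. For $\omega\in U_n(K)$ let $T^{\omega}_{nm^2}(q)$ denote the Hopf algebra over $K$ generated as a unital associative algebra by $g,h,x$ subject to the relations $$g^n=h^m=1,\qquad x^m=0,\qquad xh=q\,hx,\qquad hg=gh,\qquad gx=\omega\,xg,$$ with comultiplication, counit and antipode determined by $$\Delta(g)=g\otimes g,\qquad \Delta(h)=h\otimes h,\qquad \Delta(x)=x\otimes h+1\otimes x,$$ $$\varepsilon(g)=\varepsilon(h)=1,\qquad \varepsilon(x)=0,\qquad S(g)=g^{n-1},\qquad S(h)=h^{m-1},\qquad S(x)=-x h^{m-1}.$$ Let $\xi$ be a generator of $U_n(K)$ and let $t,t'\in\{0,1,\dots,\nu(n)-1\}$. Then the Hopf algebras $T^{\xi^{t}}_{nm^2}(q)$ and $T^{\xi^{t'}}_{nm^2}(q)$ are isomorphic if and only if there exist $l\in\{0,1,\dots,m-1\}$ and $s\in\{0,1,\dots,n-1\}$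 such that $\gcd(s,n)=1$ and $\xi^{st'-t}=q^{l}$. -/

import Mathlib

open scoped TensorProduct

/-! ### The `q`-binomial theorem at a primitive root of unity

These facts are needed only to see that the comultiplication below respects `x ^ m = 0`. -/

namespace QBinomial

/-- The `q`-integer `1 + q + ⋯ + q ^ (k - 1)`. -/
def qInt {K : Type*} [Field K] (q : K) (k : ℕ) : K := ∑ i ∈ Finset.range k, q ^ i

/-- The `q`-factorial. -/
def qFact {K : Type*} [Field K] (q : K) (k : ℕ) : K := ∏ i ∈ Finset.range k, qInt q (i + 1)

/-- The Gaussian binomial coefficient of `a ^ i * b ^ j` in `(a + b) ^ (i + j)`,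
where `b * a = q • (a * b)`. -/
def coeff {K : Type*} [Field K] (q : K) : ℕ → ℕ → K
  | 0, _ => 1
  | _ + 1, 0 => 1
  | i + 1, j + 1 => coeff q i (j + 1) + q ^ (i + 1) * coeff q (i + 1) j

theorem coeff_zero_right {K : Type*} [Field K] (q : K) (i : ℕ) : coeff q i 0 = 1 := by
  cases i <;> simp [coeff]

theorem coeff_zero_left {K : Type*} [Field K] (q : K) (j : ℕ) : coeff q 0 j = 1 := by
  simp [coeff]

theorem qFact_succ {K : Type*} [Field K] (q : K) (k : ℕ) :
    qFact q (k + 1) = qFact q k * qInt q (k + 1) := by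
  simp [qFact, Finset.prod_range_succ]

theorem qInt_add {K : Type*} [Field K] (q : K) (i j : ℕ) :
    qInt q (i + j) = qInt q i + q ^ i * qInt q j := by
  simp [qInt, Finset.sum_range_add, Finset.mul_sum, pow_add]

theorem coeff_mul_qFact {K : Type*} [Field K] (q : K) : ∀ i j : ℕ,
    coeff q i j * (qFact q i * qFact q j) = qFact q (i + j)
  | 0, j => by simp [coeff, qFact]
  | i + 1, 0 => by simp [coeff, qFact]
  | i + 1, j + 1 => by
    have h1 := coeff_mul_qFact q i (j + 1)
    have h2 := coeff_mul_qFact q (i + 1) j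
    have h3 : i + 1 + j = i + (j + 1) := by ring
    have h4 : i + 1 + (j + 1) = (i + (j + 1)) + 1 := by ring
    rw [h3] at h2
    have h5 : qInt q (i + (j + 1) + 1) = qInt q (i + 1) + q ^ (i + 1) * qInt q (j + 1) := by
      rw [← qInt_add, h4]
    rw [h4, qFact_succ q (i + (j + 1)), h5, mul_add]
    nth_rewrite 1 [← h1]
    rw [← h2, coeff, qFact_succ q i, qFact_succ q j]
    ring

theorem qInt_ne_zero {K : Type*} [Field K] {q : K} {m k : ℕ} (hq : IsPrimitiveRoot q m)
    (hk : 0 < k) (hkm : k < m) : qInt q k ≠ 0 := by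
  intro h
  have h1 : qInt q k * (q - 1) = q ^ k - 1 := geom_sum_mul q k
  rw [h, zero_mul] at h1
  exact hq.pow_ne_one_of_pos_of_lt hk.ne' hkm (sub_eq_zero.mp h1.symm)

theorem qFact_ne_zero {K : Type*} [Field K] {q : K} {m k : ℕ} (hq : IsPrimitiveRoot q m)
    (hkm : k < m) : qFact q k ≠ 0 := by
  rw [qFact, Finset.prod_ne_zero_iff]
  intro i hi
  have := Finset.mem_range.mp hi
  exact qInt_ne_zero hq (by omega) (by omega)

theorem coeff_eq_zero {K : Type*} [Field K] {q : K} {i j : ℕ}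
    (hq : IsPrimitiveRoot q (i + j)) (hi : 0 < i) (hj : 0 < j) : coeff q i j = 0 := by
  have h := coeff_mul_qFact q i j
  have h0 : qFact q (i + j) = 0 := by
    obtain ⟨k, hk⟩ : ∃ k, i + j = k + 1 := ⟨i + j - 1, by omega⟩
    have h1 : qInt q (i + j) = 0 := hq.geom_sum_eq_zero (by omega)
    rw [hk] at h1 ⊢
    rw [qFact_succ, h1, mul_zero]
  rw [h0] at h
  exact (mul_eq_zero.mp h).resolve_right
    (mul_ne_zero (qFact_ne_zero hq (by omega)) (qFact_ne_zero hq (by omega)))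

theorem mul_pow_of_skew {K A : Type*} [Field K] [Ring A] [Algebra K A] {q : K} {a b : A}
    (hab : b * a = q • (a * b)) (k : ℕ) : b * a ^ k = q ^ k • (a ^ k * b) := by
  induction k with
  | zero => simp
  | succ k ih =>
    rw [pow_succ, ← mul_assoc, ih, smul_mul_assoc, mul_assoc, hab, mul_smul_comm, smul_smul,
      ← mul_assoc, pow_succ]

theorem qAdd_pow {K A : Type*} [Field K] [Ring A] [Algebra K A] {q : K} {a b : A}
    (hab : b * a = q • (a * b)) (k : ℕ) :
    (a + b) ^ k = ∑ p ∈ Finset.HasAntidiagonal.antidiagonal k, coeff q p.1 p.2 • (a ^ p.1 * b ^ p.2) := by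
  induction k with
  | zero => simp [coeff]
  | succ k ih =>
    have e1 : ∀ i j : ℕ, (a + b) * (coeff q i j • (a ^ i * b ^ j)) =
        coeff q i j • (a ^ (i + 1) * b ^ j) + (q ^ i * coeff q i j) • (a ^ i * b ^ (j + 1)) := by
      intro i j
      rw [mul_smul_comm, add_mul, smul_add, ← mul_assoc, ← mul_assoc, ← pow_succ',
        mul_pow_of_skew hab, smul_mul_assoc, mul_assoc (a ^ i), ← pow_succ', smul_smul,
        mul_comm (coeff q i j)]
    rw [pow_succ', ih, Finset.mul_sum]
    simp only [e1, Finset.sum_add_distrib]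
    cases k with
    | zero => simp [coeff, Finset.Nat.antidiagonal_succ, add_comm]
    | succ k =>
      rw [Finset.Nat.sum_antidiagonal_succ' (n := k)
        (f := fun p : ℕ × ℕ => coeff q p.1 p.2 • (a ^ (p.1 + 1) * b ^ p.2))]
      rw [Finset.Nat.sum_antidiagonal_succ (n := k)
        (f := fun p : ℕ × ℕ => (q ^ p.1 * coeff q p.1 p.2) • (a ^ p.1 * b ^ (p.2 + 1)))]
      rw [Finset.Nat.sum_antidiagonal_succ (n := k + 1), Finset.Nat.sum_antidiagonal_succ' (n := k)]
      simp only [coeff, coeff_zero_right, coeff_zero_left, add_smul, Finset.sum_add_distrib,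
        pow_zero, one_mul, mul_one, one_smul]
      abel

theorem qAdd_pow_eq {K A : Type*} [Field K] [Ring A] [Algebra K A] {q : K} {m : ℕ} [NeZero m]
    (hq : IsPrimitiveRoot q m) {a b : A} (hab : b * a = q • (a * b)) :
    (a + b) ^ m = a ^ m + b ^ m := by
  obtain ⟨k, rfl⟩ : ∃ k, m = k + 1 := ⟨m - 1, by have := NeZero.pos m; omega⟩
  rw [qAdd_pow hab]
  cases k with
  | zero => simp [coeff, Finset.Nat.antidiagonal_succ, add_comm]
  | succ k =>
    rw [Finset.Nat.sum_antidiagonal_succ (n := k + 1), Finset.Nat.sum_antidiagonal_succ' (n := k),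
      Finset.sum_eq_zero]
    · simp [coeff, coeff_zero_right, add_comm]
    · rintro ⟨i, j⟩ hp
      have hp' : i + j = k := by simpa using hp
      have h : IsPrimitiveRoot q ((i + 1) + (j + 1)) := by
        have : i + 1 + (j + 1) = k + 1 + 1 := by omega
        rwa [this]
      simp [coeff_eq_zero h]

end QBinomial

/-! ### The Hopf algebra `T_{nm²}^ω(q)` -/

/-- The three generators. -/
inductive TaftGen : Type
  | g | h | x

/-- The defining relations
`gⁿ = hᵐ = 1`, `xᵐ = 0`, `x h = q h x`, `h g = g h`, `g x = ω x g`. -/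
inductive TaftRel {K : Type*} [Field K] (n m : ℕ) (q ω : K) :
    FreeAlgebra K TaftGen → FreeAlgebra K TaftGen → Prop
  | g_pow : TaftRel n m q ω (FreeAlgebra.ι K TaftGen.g ^ n) 1
  | h_pow : TaftRel n m q ω (FreeAlgebra.ι K TaftGen.h ^ m) 1
  | x_pow : TaftRel n m q ω (FreeAlgebra.ι K TaftGen.x ^ m) 0
  | x_h : TaftRel n m q ω (FreeAlgebra.ι K TaftGen.x * FreeAlgebra.ι K TaftGen.h)
      (q • (FreeAlgebra.ι K TaftGen.h * FreeAlgebra.ι K TaftGen.x))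
  | h_g : TaftRel n m q ω (FreeAlgebra.ι K TaftGen.h * FreeAlgebra.ι K TaftGen.g)
      (FreeAlgebra.ι K TaftGen.g * FreeAlgebra.ι K TaftGen.h)
  | g_x : TaftRel n m q ω (FreeAlgebra.ι K TaftGen.g * FreeAlgebra.ι K TaftGen.x)
      (ω • (FreeAlgebra.ι K TaftGen.x * FreeAlgebra.ι K TaftGen.g))

/-- The unital associative `K`-algebra `T_{nm²}^ω(q)` presented by the generators `g`, `h`, `x`
and the relations `TaftRel`. -/
def TaftT {K : Type*} [Field K] (n m : ℕ) (q ω : K) : Type _ := RingQuot (TaftRel n m q ω)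

namespace TaftT

noncomputable section

instance {K : Type*} [Field K] (n m : ℕ) (q ω : K) : Ring (TaftT n m q ω) :=
  inferInstanceAs (Ring (RingQuot (TaftRel n m q ω)))

instance {K : Type*} [Field K] (n m : ℕ) (q ω : K) : Algebra K (TaftT n m q ω) :=
  inferInstanceAs (Algebra K (RingQuot (TaftRel n m q ω)))

/-- The quotient map from the free algebra. -/
def mk {K : Type*} [Field K] (n m : ℕ) (q ω : K) : FreeAlgebra K TaftGen →ₐ[K] TaftT n m q ω :=
  RingQuot.mkAlgHom K (TaftRel n m q ω)

/-- The generator `g`. -/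
def g {K : Type*} [Field K] (n m : ℕ) (q ω : K) : TaftT n m q ω :=
  mk n m q ω (FreeAlgebra.ι K TaftGen.g)

/-- The generator `h`. -/
def h {K : Type*} [Field K] (n m : ℕ) (q ω : K) : TaftT n m q ω :=
  mk n m q ω (FreeAlgebra.ι K TaftGen.h)

/-- The generator `x`. -/
def x {K : Type*} [Field K] (n m : ℕ) (q ω : K) : TaftT n m q ω :=
  mk n m q ω (FreeAlgebra.ι K TaftGen.x)

section relations

variable {K : Type*} [Field K] (n m : ℕ) (q ω : K)

theorem mk_rel {a b : FreeAlgebra K TaftGen} (hab : TaftRel n m q ω a b) :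
    mk n m q ω a = mk n m q ω b := RingQuot.mkAlgHom_rel K hab

theorem g_pow : g n m q ω ^ n = 1 := by simpa [g] using mk_rel n m q ω .g_pow

theorem h_pow : h n m q ω ^ m = 1 := by simpa [h] using mk_rel n m q ω .h_pow

theorem x_pow : x n m q ω ^ m = 0 := by simpa [x] using mk_rel n m q ω .x_pow

theorem x_mul_h : x n m q ω * h n m q ω = q • (h n m q ω * x n m q ω) := by
  simpa [x, h] using mk_rel n m q ω .x_h

theorem h_mul_g : h n m q ω * g n m q ω = g n m q ω * h n m q ω := by
  simpa [g, h] using mk_rel n m q ω .h_g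

theorem g_mul_x : g n m q ω * x n m q ω = ω • (x n m q ω * g n m q ω) := by
  simpa [g, x] using mk_rel n m q ω .g_x

end relations

/-- The universal property of the presentation. -/
def lift {K : Type*} [Field K] {n m : ℕ} {q ω : K} {B : Type*} [Ring B] [Algebra K B]
    (g' h' x' : B) (hg : g' ^ n = 1) (hh : h' ^ m = 1) (hx : x' ^ m = 0)
    (hxh : x' * h' = q • (h' * x')) (hhg : h' * g' = g' * h') (hgx : g' * x' = ω • (x' * g')) :
    TaftT n m q ω →ₐ[K] B :=
  RingQuot.liftAlgHom K ⟨FreeAlgebra.lift K fun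
    | TaftGen.g => g'
    | TaftGen.h => h'
    | TaftGen.x => x', by
    intro a b hab
    cases hab <;> simpa⟩

section lift

variable {K : Type*} [Field K] {n m : ℕ} {q ω : K} {B : Type*} [Ring B] [Algebra K B]
    (g' h' x' : B) (hg : g' ^ n = 1) (hh : h' ^ m = 1) (hx : x' ^ m = 0)
    (hxh : x' * h' = q • (h' * x')) (hhg : h' * g' = g' * h') (hgx : g' * x' = ω • (x' * g'))

theorem lift_g : lift g' h' x' hg hh hx hxh hhg hgx (g n m q ω) = g' := by
  rw [lift, g, mk]
  exact (RingQuot.liftAlgHom_mkAlgHom_apply ..).trans (by simp)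

theorem lift_h : lift g' h' x' hg hh hx hxh hhg hgx (h n m q ω) = h' := by
  rw [lift, h, mk]
  exact (RingQuot.liftAlgHom_mkAlgHom_apply ..).trans (by simp)

theorem lift_x : lift g' h' x' hg hh hx hxh hhg hgx (x n m q ω) = x' := by
  rw [lift, x, mk]
  exact (RingQuot.liftAlgHom_mkAlgHom_apply ..).trans (by simp)

end lift

theorem induction {K : Type*} [Field K] {n m : ℕ} {q ω : K} {P : TaftT n m q ω → Prop}
    (hK : ∀ r : K, P (algebraMap K _ r)) (hg : P (g n m q ω)) (hh : P (h n m q ω))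
    (hx : P (x n m q ω)) (hmul : ∀ a b, P a → P b → P (a * b))
    (hadd : ∀ a b, P a → P b → P (a + b)) (a : TaftT n m q ω) : P a := by
  obtain ⟨a, rfl⟩ : ∃ b, mk n m q ω b = a := RingQuot.mkAlgHom_surjective K _ a
  induction a using FreeAlgebra.induction with
  | grade0 r => simpa using hK r
  | grade1 y => cases y <;> assumption
  | mul a b ha hb => simpa using hmul _ _ ha hb
  | add a b ha hb => simpa using hadd _ _ ha hb

theorem algHom_ext {K : Type*} [Field K] {n m : ℕ} {q ω : K} {B : Type*} [Semiring B]
    [Algebra K B] {f f' : TaftT n m q ω →ₐ[K] B} (hg : f (g n m q ω) = f' (g n m q ω))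
    (hh : f (h n m q ω) = f' (h n m q ω)) (hx : f (x n m q ω) = f' (x n m q ω)) : f = f' := by
  ext a
  induction a using TaftT.induction with
  | hK r => simp
  | hg => exact hg
  | hh => exact hh
  | hx => exact hx
  | hmul a b ha hb => simp [ha, hb]
  | hadd a b ha hb => simp [ha, hb]

section hopf

variable {K : Type*} [Field K] (n m : ℕ) (q ω : K)

theorem x_skew : ((1 : TaftT n m q ω) ⊗ₜ[K] x n m q ω) * (x n m q ω ⊗ₜ[K] h n m q ω) =
    q • ((x n m q ω ⊗ₜ[K] h n m q ω) * ((1 : TaftT n m q ω) ⊗ₜ[K] x n m q ω)) := by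
  simp [x_mul_h]

theorem tmul_g_pow : (g n m q ω ⊗ₜ[K] g n m q ω) ^ n = (1 : TaftT n m q ω ⊗[K] TaftT n m q ω) := by
  simp [g_pow, Algebra.TensorProduct.one_def]

theorem tmul_h_pow : (h n m q ω ⊗ₜ[K] h n m q ω) ^ m = (1 : TaftT n m q ω ⊗[K] TaftT n m q ω) := by
  simp [h_pow, Algebra.TensorProduct.one_def]

theorem tmul_x_pow [NeZero m] [hq : Fact (IsPrimitiveRoot q m)] :
    (x n m q ω ⊗ₜ[K] h n m q ω + 1 ⊗ₜ[K] x n m q ω) ^ m = (0 : TaftT n m q ω ⊗[K] TaftT n m q ω) := by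
  rw [QBinomial.qAdd_pow_eq hq.out (x_skew n m q ω)]
  simp [x_pow]

theorem tmul_x_mul_h : (x n m q ω ⊗ₜ[K] h n m q ω + 1 ⊗ₜ[K] x n m q ω) * (h n m q ω ⊗ₜ[K] h n m q ω) =
    q • ((h n m q ω ⊗ₜ[K] h n m q ω) * (x n m q ω ⊗ₜ[K] h n m q ω + 1 ⊗ₜ[K] x n m q ω)) := by
  simp [add_mul, mul_add, x_mul_h, TensorProduct.smul_tmul']

theorem tmul_h_mul_g : (h n m q ω ⊗ₜ[K] h n m q ω) * (g n m q ω ⊗ₜ[K] g n m q ω) = (g n m q ω ⊗ₜ[K] g n m q ω) * (h n m q ω ⊗ₜ[K] h n m q ω) := by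
  simp [h_mul_g]

theorem tmul_g_mul_x : (g n m q ω ⊗ₜ[K] g n m q ω) * (x n m q ω ⊗ₜ[K] h n m q ω + 1 ⊗ₜ[K] x n m q ω) =
    ω • ((x n m q ω ⊗ₜ[K] h n m q ω + 1 ⊗ₜ[K] x n m q ω) * (g n m q ω ⊗ₜ[K] g n m q ω)) := by
  simp [add_mul, mul_add, g_mul_x, h_mul_g, TensorProduct.smul_tmul']

/-- `Δ(g) = g ⊗ g`, `Δ(h) = h ⊗ h`, `Δ(x) = x ⊗ h + 1 ⊗ x`, extended to an algebra map. -/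
def comulHom [NeZero m] [Fact (IsPrimitiveRoot q m)] :
    TaftT n m q ω →ₐ[K] TaftT n m q ω ⊗[K] TaftT n m q ω :=
  lift (g n m q ω ⊗ₜ[K] g n m q ω) (h n m q ω ⊗ₜ[K] h n m q ω)
    (x n m q ω ⊗ₜ[K] h n m q ω + 1 ⊗ₜ[K] x n m q ω)
    (tmul_g_pow n m q ω) (tmul_h_pow n m q ω) (tmul_x_pow n m q ω) (tmul_x_mul_h n m q ω)
    (tmul_h_mul_g n m q ω) (tmul_g_mul_x n m q ω)

/-- `ε(g) = ε(h) = 1`, `ε(x) = 0`, extended to an algebra map. -/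
def counitHom [NeZero m] : TaftT n m q ω →ₐ[K] K :=
  lift 1 1 0 (by simp) (by simp) (by simp [NeZero.ne m]) (by simp) (by simp) (by simp)

theorem comulHom_g [NeZero m] [Fact (IsPrimitiveRoot q m)] :
    comulHom n m q ω (g n m q ω) = g n m q ω ⊗ₜ[K] g n m q ω := by
  rw [comulHom, lift_g]

theorem comulHom_h [NeZero m] [Fact (IsPrimitiveRoot q m)] :
    comulHom n m q ω (h n m q ω) = h n m q ω ⊗ₜ[K] h n m q ω := by
  rw [comulHom, lift_h]

theorem comulHom_x [NeZero m] [Fact (IsPrimitiveRoot q m)] :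
    comulHom n m q ω (x n m q ω) = x n m q ω ⊗ₜ[K] h n m q ω + 1 ⊗ₜ[K] x n m q ω := by
  rw [comulHom, lift_x]

theorem counitHom_g [NeZero m] : counitHom n m q ω (g n m q ω) = 1 := by
  rw [counitHom, lift_g]

theorem counitHom_h [NeZero m] : counitHom n m q ω (h n m q ω) = 1 := by
  rw [counitHom, lift_h]

theorem counitHom_x [NeZero m] : counitHom n m q ω (x n m q ω) = 0 := by
  rw [counitHom, lift_x]

instance [NeZero m] [Fact (IsPrimitiveRoot q m)] : Bialgebra K (TaftT n m q ω) :=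
  Bialgebra.ofAlgHom (comulHom n m q ω) (counitHom n m q ω)
    (by
      apply algHom_ext <;>
        simp [comulHom_g, comulHom_h, comulHom_x, Algebra.TensorProduct.one_def,
          TensorProduct.add_tmul, TensorProduct.tmul_add, add_assoc])
    (by
      apply algHom_ext <;>
        simp [comulHom_g, comulHom_h, comulHom_x, counitHom_g, counitHom_h, counitHom_x])
    (by
      apply algHom_ext <;>
        simp [comulHom_g, comulHom_h, comulHom_x, counitHom_g, counitHom_h, counitHom_x])

theorem g_inv [NeZero n] : g n m q ω ^ (n - 1) * g n m q ω = 1 := by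
  rw [← pow_succ, Nat.sub_add_cancel NeZero.one_le, g_pow]

theorem g_inv' [NeZero n] : g n m q ω * g n m q ω ^ (n - 1) = 1 := by
  rw [← pow_succ', Nat.sub_add_cancel NeZero.one_le, g_pow]

theorem h_inv [NeZero m] : h n m q ω ^ (m - 1) * h n m q ω = 1 := by
  rw [← pow_succ, Nat.sub_add_cancel NeZero.one_le, h_pow]

theorem h_inv' [NeZero m] : h n m q ω * h n m q ω ^ (m - 1) = 1 := by
  rw [← pow_succ', Nat.sub_add_cancel NeZero.one_le, h_pow]

theorem h_inv_mul_x [NeZero m] :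
    h n m q ω ^ (m - 1) * x n m q ω = q • (x n m q ω * h n m q ω ^ (m - 1)) := by
  calc h n m q ω ^ (m - 1) * x n m q ω
      = h n m q ω ^ (m - 1) * (x n m q ω * h n m q ω) * h n m q ω ^ (m - 1) := by
        rw [mul_assoc, mul_assoc, h_inv', mul_one]
    _ = q • (x n m q ω * h n m q ω ^ (m - 1)) := by
        rw [x_mul_h, mul_smul_comm, ← mul_assoc, h_inv, one_mul, smul_mul_assoc]

theorem x_mul_g_inv [NeZero n] :
    x n m q ω * g n m q ω ^ (n - 1) = ω • (g n m q ω ^ (n - 1) * x n m q ω) := by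
  calc x n m q ω * g n m q ω ^ (n - 1)
      = g n m q ω ^ (n - 1) * (g n m q ω * x n m q ω) * g n m q ω ^ (n - 1) := by
        rw [← mul_assoc, g_inv, one_mul]
    _ = ω • (g n m q ω ^ (n - 1) * x n m q ω) := by
        rw [g_mul_x, mul_smul_comm, smul_mul_assoc, mul_assoc, mul_assoc, g_inv', mul_one]

theorem commute_inv : Commute (h n m q ω ^ (m - 1)) (g n m q ω ^ (n - 1)) :=
  Commute.pow_pow (h_mul_g n m q ω) _ _

theorem x_mul_h_pow_pow (k j : ℕ) : ∃ c : K, (x n m q ω * h n m q ω ^ k) ^ j =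
    c • (h n m q ω ^ (k * j) * x n m q ω ^ j) := by
  induction j with
  | zero => exact ⟨1, by simp⟩
  | succ j ih =>
    obtain ⟨c, hc⟩ := ih
    refine ⟨c * q ^ (k * (j + 1)), ?_⟩
    rw [pow_succ', hc, mul_smul_comm, mul_smul, ← mul_assoc, mul_assoc (x n m q ω), ← pow_add,
      show k + k * j = k * (j + 1) by ring, QBinomial.mul_pow_of_skew (x_mul_h n m q ω),
      smul_mul_assoc, mul_assoc, ← pow_succ']

/-- `S(g) = gⁿ⁻¹`, `S(h) = hᵐ⁻¹`, `S(x) = -x hᵐ⁻¹`, extended to an algebra map into the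
opposite algebra. -/
def antipodeHom [NeZero n] [NeZero m] : TaftT n m q ω →ₐ[K] (TaftT n m q ω)ᵐᵒᵖ :=
  lift (MulOpposite.op (g n m q ω ^ (n - 1))) (MulOpposite.op (h n m q ω ^ (m - 1)))
    (MulOpposite.op (-(x n m q ω * h n m q ω ^ (m - 1))))
    (by
      apply MulOpposite.unop_injective
      simp [pow_right_comm _ (n - 1) n, g_pow])
    (by
      apply MulOpposite.unop_injective
      simp [pow_right_comm _ (m - 1) m, h_pow])
    (by
      apply MulOpposite.unop_injective
      obtain ⟨c, hc⟩ := x_mul_h_pow_pow n m q ω (m - 1) m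
      simp [neg_pow (x n m q ω * h n m q ω ^ (m - 1)), hc, x_pow])
    (by
      apply MulOpposite.unop_injective
      simp [← mul_assoc, h_inv_mul_x])
    (by
      apply MulOpposite.unop_injective
      simpa using (commute_inv n m q ω).eq.symm)
    (by
      apply MulOpposite.unop_injective
      simp [mul_assoc, (commute_inv n m q ω).eq]
      simp [← mul_assoc, x_mul_g_inv])

theorem antipodeHom_g [NeZero n] [NeZero m] :
    antipodeHom n m q ω (g n m q ω) = MulOpposite.op (g n m q ω ^ (n - 1)) := by
  rw [antipodeHom, lift_g]

theorem antipodeHom_h [NeZero n] [NeZero m] :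
    antipodeHom n m q ω (h n m q ω) = MulOpposite.op (h n m q ω ^ (m - 1)) := by
  rw [antipodeHom, lift_h]

theorem antipodeHom_x [NeZero n] [NeZero m] : antipodeHom n m q ω (x n m q ω) =
    MulOpposite.op (-(x n m q ω * h n m q ω ^ (m - 1))) := by
  rw [antipodeHom, lift_x]

/-- The antipode as a linear endomorphism. -/
def antipodeLin [NeZero n] [NeZero m] : TaftT n m q ω →ₗ[K] TaftT n m q ω :=
  (MulOpposite.opLinearEquiv K).symm.toLinearMap ∘ₗ (antipodeHom n m q ω).toLinearMap

theorem antipodeLin_apply [NeZero n] [NeZero m] (a : TaftT n m q ω) :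
    antipodeLin n m q ω a = (antipodeHom n m q ω a).unop := rfl

theorem antipodeLin_mul [NeZero n] [NeZero m] (a b : TaftT n m q ω) :
    antipodeLin n m q ω (a * b) = antipodeLin n m q ω b * antipodeLin n m q ω a := by
  simp [antipodeLin_apply]

end hopf

section antipode

variable {K A : Type*} [Field K] [Ring A] [Algebra K A] (S : A →ₗ[K] A)

theorem rTensor_mul_of_anti (hS : ∀ a b, S (a * b) = S b * S a) {c : K} {u : A ⊗[K] A}
    (hu : LinearMap.mul' K A (S.rTensor A u) = algebraMap K A c) (v : A ⊗[K] A) :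
    LinearMap.mul' K A (S.rTensor A (u * v)) = c • LinearMap.mul' K A (S.rTensor A v) := by
  induction v using TensorProduct.induction_on with
  | zero => simp
  | add v w hv hw => simp [mul_add, hv, hw]
  | tmul b b' =>
    have key : ∀ u : A ⊗[K] A, LinearMap.mul' K A (S.rTensor A (u * b ⊗ₜ[K] b')) =
        S b * LinearMap.mul' K A (S.rTensor A u) * b' := by
      intro u
      induction u using TensorProduct.induction_on with
      | zero => simp
      | add v w hv hw => simp [mul_add, add_mul, hv, hw]
      | tmul a a' => simp [hS, mul_assoc]
    rw [key, hu, ← Algebra.commutes, mul_assoc, ← Algebra.smul_def]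
    simp

theorem lTensor_mul_of_anti (hS : ∀ a b, S (a * b) = S b * S a) {c : K} {v : A ⊗[K] A}
    (hv : LinearMap.mul' K A (S.lTensor A v) = algebraMap K A c) (u : A ⊗[K] A) :
    LinearMap.mul' K A (S.lTensor A (u * v)) = c • LinearMap.mul' K A (S.lTensor A u) := by
  induction u using TensorProduct.induction_on with
  | zero => simp
  | add v w hv hw => simp [add_mul, hv, hw]
  | tmul b b' =>
    have key : ∀ v : A ⊗[K] A, LinearMap.mul' K A (S.lTensor A (b ⊗ₜ[K] b' * v)) =
        b * LinearMap.mul' K A (S.lTensor A v) * S b' := by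
      intro v
      induction v using TensorProduct.induction_on with
      | zero => simp
      | add v w hv hw => simp [mul_add, add_mul, hv, hw]
      | tmul a a' => simp [hS, mul_assoc]
    rw [key, hv, ← Algebra.commutes, mul_assoc, ← Algebra.smul_def]
    simp

end antipode

section hopfInstance

variable {K : Type*} [Field K] (n m : ℕ) (q ω : K)
  [NeZero n] [NeZero m] [Fact (IsPrimitiveRoot q m)]

theorem antipode_left (a : TaftT n m q ω) :
    LinearMap.mul' K _ ((antipodeLin n m q ω).rTensor _ (comulHom n m q ω a)) =
      algebraMap K _ (counitHom n m q ω a) := by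
  induction a using TaftT.induction with
  | hK r => simp [Algebra.algebraMap_eq_smul_one, Algebra.TensorProduct.one_def,
      antipodeLin_apply]
  | hg => simp [comulHom_g, counitHom_g, antipodeLin_apply, antipodeHom_g, g_inv]
  | hh => simp [comulHom_h, counitHom_h, antipodeLin_apply, antipodeHom_h, h_inv]
  | hx => simp [comulHom_x, counitHom_x, antipodeLin_apply, antipodeHom_x, mul_assoc, h_inv]
  | hmul a b ha hb =>
    rw [map_mul, rTensor_mul_of_anti _ (antipodeLin_mul n m q ω) ha, hb, map_mul, map_mul,
      Algebra.smul_def]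
  | hadd a b ha hb => simp [ha, hb]

theorem antipode_right (a : TaftT n m q ω) :
    LinearMap.mul' K _ ((antipodeLin n m q ω).lTensor _ (comulHom n m q ω a)) =
      algebraMap K _ (counitHom n m q ω a) := by
  induction a using TaftT.induction with
  | hK r => simp [Algebra.algebraMap_eq_smul_one, Algebra.TensorProduct.one_def,
      antipodeLin_apply]
  | hg => simp [comulHom_g, counitHom_g, antipodeLin_apply, antipodeHom_g, g_inv']
  | hh => simp [comulHom_h, counitHom_h, antipodeLin_apply, antipodeHom_h, h_inv']
  | hx => simp [comulHom_x, counitHom_x, antipodeLin_apply, antipodeHom_x, antipodeHom_h]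
  | hmul a b ha hb =>
    rw [map_mul, lTensor_mul_of_anti _ (antipodeLin_mul n m q ω) hb, ha, map_mul, map_mul,
      Algebra.smul_def, Algebra.commutes]
  | hadd a b ha hb => simp [ha, hb]

/-- The Hopf algebra structure on `T_{nm²}^ω(q)`. -/
instance : HopfAlgebra K (TaftT n m q ω) where
  antipode := antipodeLin n m q ω
  mul_antipode_rTensor_comul := LinearMap.ext (antipode_left n m q ω)
  mul_antipode_lTensor_comul := LinearMap.ext (antipode_right n m q ω)

end hopfInstance

end

end TaftT

/-- Two Hopf algebras are isomorphic if there is a bijective algebra and coalgebra map between them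
that commutes with the antipodes. -/
def HopfIsomorphic (K A B : Type*) [Field K] [Ring A] [Ring B] [HopfAlgebra K A]
    [HopfAlgebra K B] : Prop :=
  ∃ e : A ≃ₐc[K] B, ∀ a : A, e (HopfAlgebra.antipode K a) = HopfAlgebra.antipode K (e a)

/-! If `ω' ^ s = q ^ l * ω`, then `g ↦ g ^ s * h ^ l`, `h ↦ h`, `x ↦ x` respects the relations, and
a map of the same shape, built from an inverse of `s` modulo `n`, inverts it
(`hopfIsomorphic_of_pow_eq`).

For the converse no basis is needed, only two shadows of the algebra. Killing `x` gives `proj`, with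
values in the commutative group algebra of `C_n × C_m`. The corner entry of a triangular
representation gives `degOne`, a twisted derivation with value 1 at `x`. One identity,
`map_proj_degOne_comm`, carries the argument: flipping the comultiplication before applying `proj ⊗
degOne` multiplies the result by `h ⊗ 1`. Hence `degOne` vanishes on group-likes, and a
skew-primitive with nonzero `degOne` has a group-like whose projection is `h`.

Let `e` be an isomorphism. It cannot send `x` to the kernel of `degOne`, so `e h` projects to `h`,
and `x h = q h x` forces `e x` to project to 0. If `e g` projects to the group element `u`, then `g
x = ω x g` says that the character by which `u` acts on `x` equals `ω`; this is `ω' ^ s = q ^ l *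
ω`, with `s` and `l` the coordinates of `u`. Surjectivity of `e` makes `s` prime to `n`. -/

theorem TensorProduct.tmul_right_cancel {K V W : Type*} [Field K] [AddCommGroup V] [Module K V]
    [AddCommGroup W] [Module K W] {a b : V} {z : W} (hz : z ≠ 0)
    (h : a ⊗ₜ[K] z = b ⊗ₜ[K] z) : a = b := by
  obtain ⟨f, hf⟩ : ∃ f : Module.Dual K W, f z ≠ 0 := by
    by_contra! hf
    exact hz ((Module.forall_dual_apply_eq_zero_iff K z).mp hf)
  -- Contracting the second leg with `f` leaves `f z • a = f z • b`.
  have := congrArg (TensorProduct.rid K V ∘ f.lTensor V) h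
  simpa [hf] using this

namespace TaftT

noncomputable section

/-! ### The group algebra of `C_n × C_m` -/

/-- The group `C_n × C_m` of the monomials `g ^ i * h ^ j`. -/
abbrev Grp (n m : ℕ) : Type := Multiplicative (ZMod n × ZMod m)

/-- The group algebra of `Grp n m`. -/
abbrev GrpAlg (K : Type*) [Field K] (n m : ℕ) : Type _ := MonoidAlgebra K (Grp n m)

section groupAlgebra

variable (K : Type*) [Field K] (n m : ℕ)

/-- The class of `g` in the group algebra. -/
def gBar : GrpAlg K n m := MonoidAlgebra.of K _ (Multiplicative.ofAdd (1, 0))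

/-- The class of `h` in the group algebra. -/
def hBar : GrpAlg K n m := MonoidAlgebra.of K _ (Multiplicative.ofAdd (0, 1))

theorem gBar_pow : gBar K n m ^ n = 1 := by
  rw [gBar, ← map_pow, ← ofAdd_nsmul, ← map_one (MonoidAlgebra.of K (Grp n m))]
  simp
  rfl

theorem hBar_pow : hBar K n m ^ m = 1 := by
  rw [hBar, ← map_pow, ← ofAdd_nsmul, ← map_one (MonoidAlgebra.of K (Grp n m))]
  simp
  rfl

theorem hBar_mul_ne (hm : 1 < m) {u : GrpAlg K n m} (hu : IsUnit u) :
    hBar K n m * u ≠ u := by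
  intro H
  have h1 : hBar K n m = 1 := hu.mul_right_cancel (by rw [H, one_mul])
  have h2 := MonoidAlgebra.of_injective (h1.trans (map_one (MonoidAlgebra.of K (Grp n m))).symm)
  have : Fact (1 < m) := ⟨hm⟩
  exact one_ne_zero (congrArg (fun v : Grp n m => v.toAdd.2) h2)

end groupAlgebra

/-! ### The triangular representation and its degree-one component -/

section representation

variable {K : Type*} [Field K] (n m : ℕ) [NeZero m] (q ω : K)

/-- The projection onto the group algebra killing `x`. -/
def proj : TaftT n m q ω →ₐ[K] GrpAlg K n m :=
  lift (gBar K n m) (hBar K n m) 0 (gBar_pow K n m) (hBar_pow K n m) (by simp [NeZero.ne m])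
    (by simp) (mul_comm _ _) (by simp)

theorem proj_g : proj n m q ω (g n m q ω) = gBar K n m := by rw [proj, lift_g]
theorem proj_h : proj n m q ω (h n m q ω) = hBar K n m := by rw [proj, lift_h]
theorem proj_x : proj n m q ω (x n m q ω) = 0 := by rw [proj, lift_x]

variable {n m q ω}

/-- The character of `C_n × C_m` by which the monomials `g ^ i * h ^ j` act on `x`. -/
def character [NeZero n] (hω : ω ^ n = 1) (hq : q ^ m = 1) : Grp n m →* K where
  toFun u := ω ^ u.toAdd.1.val * (q⁻¹) ^ u.toAdd.2.val
  map_one' := by simp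
  map_mul' u v := by
    have hq' : (q⁻¹) ^ m = 1 := by simp [hq]
    simp only [toAdd_mul, Prod.fst_add, Prod.snd_add, ZMod.val_add]
    rw [← pow_eq_pow_mod _ hω, ← pow_eq_pow_mod _ hq']
    ring

/-- The automorphism of the group algebra given by conjugation of `x`. -/
def twist [NeZero n] (hω : ω ^ n = 1) (hq : q ^ m = 1) : GrpAlg K n m →ₐ[K] GrpAlg K n m :=
  MonoidAlgebra.lift K _ _
    { toFun u := character hω hq u • MonoidAlgebra.of K _ u
      map_one' := by simp [MonoidAlgebra.one_def]
      map_mul' u v := by simp }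

theorem twist_of [NeZero n] (hω : ω ^ n = 1) (hq : q ^ m = 1) (u : Grp n m) :
    twist hω hq (MonoidAlgebra.of K _ u) = character hω hq u • MonoidAlgebra.of K _ u := by
  simp [twist]

theorem twist_gBar [NeZero n] (hn : 1 < n) (hω : ω ^ n = 1) (hq : q ^ m = 1) :
    twist hω hq (gBar K n m) = ω • gBar K n m := by
  have : Fact (1 < n) := ⟨hn⟩
  rw [gBar, twist_of]
  simp [character, ZMod.val_one]

theorem twist_hBar [NeZero n] (hm : 1 < m) (hω : ω ^ n = 1) (hq : q ^ m = 1) :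
    twist hω hq (hBar K n m) = q⁻¹ • hBar K n m := by
  have : Fact (1 < m) := ⟨hm⟩
  rw [hBar, twist_of]
  simp [character, ZMod.val_one]

/-- The upper triangular representation over the group algebra with `x` acting as `E₁₂`. -/
def rep (hm : 1 < m) (hω : ω ^ n = 1) (hq : q ^ m = 1) :
    TaftT n m q ω →ₐ[K] Matrix (Fin 2) (Fin 2) (GrpAlg K n m) :=
  lift (Matrix.diagonal ![ω • gBar K n m, gBar K n m])
    (Matrix.diagonal ![q⁻¹ • hBar K n m, hBar K n m]) !![0, 1; 0, 0]
    (by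
      rw [Matrix.diagonal_pow, ← Matrix.diagonal_one]
      congr 1
      ext i : 1
      fin_cases i <;> simp [smul_pow, hω, gBar_pow])
    (by
      rw [Matrix.diagonal_pow, ← Matrix.diagonal_one]
      congr 1
      ext i : 1
      fin_cases i <;> simp [smul_pow, hq, hBar_pow])
    -- The matrix `E₁₂` has square zero, and `m ≥ 2`.
    (by
      obtain ⟨k, rfl⟩ : ∃ k, m = k + 2 := ⟨m - 2, by omega⟩
      rw [pow_add, pow_two]
      convert mul_zero _
      ext i j : 2
      fin_cases i <;> fin_cases j <;> simp [Matrix.mul_apply])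
    (by
      have hq0 : q ≠ 0 := by rintro rfl; simp [NeZero.ne m] at hq
      ext i j : 2
      fin_cases i <;> fin_cases j <;> simp [Matrix.mul_apply, Matrix.smul_apply, smul_smul, hq0])
    (by simp [Matrix.diagonal_mul_diagonal, mul_comm])
    (by
      ext i j : 2
      rw [Matrix.smul_apply, Matrix.diagonal_mul, Matrix.mul_diagonal]
      fin_cases i <;> fin_cases j <;> simp)

section

variable (hm : 1 < m) (hω : ω ^ n = 1) (hq : q ^ m = 1)

theorem rep_g : rep hm hω hq (g n m q ω) = Matrix.diagonal ![ω • gBar K n m, gBar K n m] := by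
  rw [rep, lift_g]

theorem rep_h : rep hm hω hq (h n m q ω) = Matrix.diagonal ![q⁻¹ • hBar K n m, hBar K n m] := by
  rw [rep, lift_h]

theorem rep_x : rep hm hω hq (x n m q ω) = !![0, 1; 0, 0] := by
  rw [rep, lift_x]

/-- Matrices of this triangular form are closed under sums and products, so it is enough to look at
generators. The lemma makes the corner entry a twisted derivation. -/
theorem rep_eq [NeZero n] (hn : 1 < n) (a : TaftT n m q ω) : rep hm hω hq a 0 0 = twist hω hq (proj n m q ω a) ∧
    rep hm hω hq a 1 0 = 0 ∧ rep hm hω hq a 1 1 = proj n m q ω a := by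
  induction a using TaftT.induction with
  | hK r =>
    refine ⟨?_, ?_, ?_⟩
    · rw [AlgHom.commutes, AlgHom.commutes, AlgHom.commutes]
      simp [Matrix.algebraMap_eq_diagonal]
    · simp [Matrix.algebraMap_eq_diagonal]
    · simp [Matrix.algebraMap_eq_diagonal]
  | hg => simp [rep_g, proj_g, twist_gBar hn]
  | hh => simp [rep_h, proj_h, twist_hBar hm]
  | hx => simp [rep_x, proj_x]
  | hmul a b ha hb => simp [Matrix.mul_apply, ha, hb]
  | hadd a b ha hb => simp [ha, hb]

/-- The component of degree one in `x`. -/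
def degOne : TaftT n m q ω →ₗ[K] GrpAlg K n m :=
  (Matrix.entryLinearMap K (GrpAlg K n m) 0 1) ∘ₗ (rep hm hω hq).toLinearMap

theorem degOne_apply (a : TaftT n m q ω) : degOne hm hω hq a = rep hm hω hq a 0 1 := rfl

theorem degOne_g : degOne hm hω hq (g n m q ω) = 0 := by simp [degOne_apply, rep_g]
theorem degOne_h : degOne hm hω hq (h n m q ω) = 0 := by simp [degOne_apply, rep_h]
theorem degOne_x : degOne hm hω hq (x n m q ω) = 1 := by simp [degOne_apply, rep_x]

theorem degOne_algebraMap (r : K) : degOne hm hω hq (algebraMap K (TaftT n m q ω) r) = 0 := by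
  simp [degOne_apply, Matrix.algebraMap_eq_diagonal]

theorem degOne_mul [NeZero n] (hn : 1 < n) (a b : TaftT n m q ω) : degOne hm hω hq (a * b) =
    twist hω hq (proj n m q ω a) * degOne hm hω hq b + degOne hm hω hq a * proj n m q ω b := by
  simp [degOne_apply, Matrix.mul_apply, rep_eq hm hω hq hn]

end

end representation

/-! ### Group-like elements and the projection -/

section groupLike

variable {K : Type*} [Field K] {n m : ℕ} [NeZero m] {q ω : K}

variable [Fact (IsPrimitiveRoot q m)]

theorem comul_eq (a : TaftT n m q ω) :
    CoalgebraStruct.comul (R := K) a = comulHom n m q ω a := rfl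

theorem counit_eq (a : TaftT n m q ω) :
    CoalgebraStruct.counit (R := K) a = counitHom n m q ω a := rfl

/-- The group algebra is cocommutative. This matches the `proj` factors when `map_proj_degOne_comm`
is extended to products. -/
theorem map_proj_proj_comm (a : TaftT n m q ω) :
    Algebra.TensorProduct.map (proj n m q ω) (proj n m q ω)
      (Algebra.TensorProduct.comm K _ _ (comulHom n m q ω a)) =
    Algebra.TensorProduct.map (proj n m q ω) (proj n m q ω) (comulHom n m q ω a) := by
  refine DFunLike.congr_fun (algHom_ext
    (f := ((Algebra.TensorProduct.map (proj n m q ω) (proj n m q ω)).comp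
      (Algebra.TensorProduct.comm K _ _).toAlgHom).comp (comulHom n m q ω))
    (f' := (Algebra.TensorProduct.map (proj n m q ω) (proj n m q ω)).comp (comulHom n m q ω))
    ?_ ?_ ?_) a
  · simp [comulHom_g]
  · simp [comulHom_h]
  · simp [comulHom_x, proj_x]

variable (n m q ω) in
/-- The projection onto the group algebra as a map of bialgebras. -/
def projBialgHom : TaftT n m q ω →ₐc[K] GrpAlg K n m :=
  .ofAlgHom (proj n m q ω)
    (algHom_ext
      (by simp [counit_eq, counitHom_g, proj_g, gBar])
      (by simp [counit_eq, counitHom_h, proj_h, hBar])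
      (by simp [counit_eq, counitHom_x, proj_x]))
    (algHom_ext
      (by simp [comul_eq, comulHom_g, proj_g, gBar])
      (by simp [comul_eq, comulHom_h, proj_h, hBar])
      (by simp [comul_eq, comulHom_x, proj_x]))

/-- Bialgebra maps preserve group-likes, and those of a group algebra over a field are the group
elements. -/
theorem exists_proj_eq_of {w : TaftT n m q ω} (hw : IsGroupLikeElem K w) :
    ∃ u : Grp n m, MonoidAlgebra.of K _ u = proj n m q ω w :=
  MonoidAlgebra.isGroupLikeElem_iff_mem_range_of.mp (hw.map (projBialgHom n m q ω))

theorem isGroupLikeElem_g : IsGroupLikeElem K (g n m q ω) :=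
  ⟨by rw [counit_eq, counitHom_g], by rw [comul_eq, comulHom_g]⟩

theorem isGroupLikeElem_h : IsGroupLikeElem K (h n m q ω) :=
  ⟨by rw [counit_eq, counitHom_h], by rw [comul_eq, comulHom_h]⟩

theorem comul_map_x {ω' : K} (e : TaftT n m q ω ≃ₐc[K] TaftT n m q ω') :
    CoalgebraStruct.comul (R := K) (e (x n m q ω)) =
      e (x n m q ω) ⊗ₜ[K] e (h n m q ω) + 1 ⊗ₜ[K] e (x n m q ω) := by
  rw [← CoalgHomClass.map_comp_comul_apply, comul_eq, comulHom_x]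
  simp

end groupLike

/-! ### Group-likes and skew-primitives seen by `degOne` -/

section skewPrimitive

variable {K : Type*} [Field K] {n m : ℕ} [NeZero n] [NeZero m] {q ω : K}

theorem map_proj_degOne_mul (hn : 1 < n) (hm : 1 < m) (hω : ω ^ n = 1) (hq : q ^ m = 1)
    (u v : TaftT n m q ω ⊗[K] TaftT n m q ω) :
    TensorProduct.map (proj n m q ω).toLinearMap (degOne hm hω hq) (u * v) =
      Algebra.TensorProduct.map (.id K _) (twist hω hq)
        (Algebra.TensorProduct.map (proj n m q ω) (proj n m q ω) u) *
        TensorProduct.map (proj n m q ω).toLinearMap (degOne hm hω hq) v +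
      TensorProduct.map (proj n m q ω).toLinearMap (degOne hm hω hq) u *
        Algebra.TensorProduct.map (proj n m q ω) (proj n m q ω) v := by
  induction u using TensorProduct.induction_on with
  | zero => simp
  | add u u' hu hu' =>
    simp only [add_mul, map_add, hu, hu']
    abel
  | tmul a a' =>
    induction v using TensorProduct.induction_on with
    | zero => simp
    | add v v' hv hv' =>
      simp only [mul_add, map_add, hv, hv']
      abel
    | tmul b b' => simp [degOne_mul hm hω hq hn, TensorProduct.tmul_add]

variable [Fact (IsPrimitiveRoot q m)]

/-- At `x`, the flipped comultiplication `h ⊗ x + x ⊗ 1` yields `h ⊗ 1`, the original yields `1 ⊗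
1`; at `g` and `h` both sides vanish. The Leibniz rule carries the identity to products, since the
target is commutative and `h ⊗ 1` can be pulled out. -/
theorem map_proj_degOne_comm (hn : 1 < n) (hm : 1 < m) (hω : ω ^ n = 1) (hq : q ^ m = 1)
    (a : TaftT n m q ω) :
    TensorProduct.map (proj n m q ω).toLinearMap (degOne hm hω hq)
      (Algebra.TensorProduct.comm K _ _ (comulHom n m q ω a)) =
    (hBar K n m ⊗ₜ[K] 1) * TensorProduct.map (proj n m q ω).toLinearMap (degOne hm hω hq)
      (comulHom n m q ω a) := by
  induction a using TaftT.induction with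
  | hK r =>
    have h1 := degOne_algebraMap hm hω hq 1
    rw [map_one] at h1
    simp [Algebra.algebraMap_eq_smul_one, Algebra.TensorProduct.one_def, h1]
  | hg => simp [comulHom_g, degOne_g]
  | hh => simp [comulHom_h, degOne_h]
  | hx =>
    have h1 := degOne_algebraMap hm hω hq 1
    rw [map_one] at h1
    simp [comulHom_x, degOne_x, degOne_h, proj_x, proj_h, h1]
  | hmul a b ha hb =>
    rw [map_mul, map_mul, map_proj_degOne_mul hn, map_proj_degOne_mul hn, ha, hb,
      map_proj_proj_comm, map_proj_proj_comm]
    ring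
  | hadd a b ha hb => simp only [map_add, ha, hb, mul_add]

/-- The flip fixes `w ⊗ w`, so a nonzero `degOne` would make the group element under `w` equal to
its multiple by `h`. -/
theorem degOne_eq_zero (hn : 1 < n) (hm : 1 < m) (hω : ω ^ n = 1) (hq : q ^ m = 1)
    {w : TaftT n m q ω} (hw : IsGroupLikeElem K w) : degOne hm hω hq w = 0 := by
  obtain ⟨u, hu⟩ := exists_proj_eq_of hw
  have h1 := map_proj_degOne_comm hn hm hω hq w
  rw [← comul_eq, hw.comul_eq_tmul_self] at h1
  simp only [Algebra.TensorProduct.comm_tmul, TensorProduct.map_tmul, AlgHom.toLinearMap_apply,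
    ← hu, Algebra.TensorProduct.tmul_mul_tmul, one_mul] at h1
  by_contra h0
  exact hBar_mul_ne K n m hm ((Group.isUnit u).map (MonoidAlgebra.of K _))
    (TensorProduct.tmul_right_cancel h0 h1).symm

/-- Only `1 ⊗ y` survives without the flip and only `v ⊗ y` with it, because `degOne` kills `v` and
1. Cancelling `degOne y` leaves the claim. -/
theorem proj_eq_hBar (hn : 1 < n) (hm : 1 < m) (hω : ω ^ n = 1) (hq : q ^ m = 1)
    {v y : TaftT n m q ω} (hv : IsGroupLikeElem K v)
    (hy : CoalgebraStruct.comul (R := K) y = y ⊗ₜ[K] v + 1 ⊗ₜ[K] y)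
    (hy0 : degOne hm hω hq y ≠ 0) : proj n m q ω v = hBar K n m := by
  have h1 := map_proj_degOne_comm hn hm hω hq y
  have h2 := degOne_algebraMap hm hω hq 1
  rw [map_one] at h2
  rw [← comul_eq, hy] at h1
  simp only [map_add, Algebra.TensorProduct.comm_tmul, TensorProduct.map_tmul,
    AlgHom.toLinearMap_apply, degOne_eq_zero hn hm hω hq hv, h2, TensorProduct.tmul_zero,
    add_zero, zero_add, map_one, Algebra.TensorProduct.tmul_mul_tmul, one_mul, mul_one] at h1
  exact TensorProduct.tmul_right_cancel hy0 h1

end skewPrimitive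

/-! ### Constraints on an isomorphism -/

section isomorphism

variable {K : Type*} [Field K] {n m : ℕ} [NeZero n] [NeZero m] {q ω ω' : K}
  [hq : Fact (IsPrimitiveRoot q m)]

/-- Otherwise `degOne ∘ e` vanishes on all generators, hence everywhere by the Leibniz rule,
although `e` hits `x` and `degOne x = 1`. -/
theorem degOne_map_x_ne_zero (hn : 1 < n) (hm : 1 < m) (hω' : ω' ^ n = 1)
    (e : TaftT n m q ω ≃ₐc[K] TaftT n m q ω') :
    degOne hm hω' hq.out.pow_eq_one (e (x n m q ω)) ≠ 0 := by
  intro h0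
  have key : ∀ a, degOne hm hω' hq.out.pow_eq_one (e a) = 0 := by
    intro a
    induction a using TaftT.induction with
    | hK r =>
      rw [AlgHomClass.commutes, degOne_algebraMap]
    | hg => exact degOne_eq_zero hn hm _ _ (isGroupLikeElem_g.map e)
    | hh => exact degOne_eq_zero hn hm _ _ (isGroupLikeElem_h.map e)
    | hx => exact h0
    | hmul a b ha hb => rw [map_mul, degOne_mul _ _ _ hn, ha, hb]; simp
    | hadd a b ha hb => simp [ha, hb]
  have := key (e.symm (x n m q ω'))
  rw [BialgEquiv.apply_symm_apply, degOne_x] at this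
  exact one_ne_zero this

/-- In a commutative algebra `x h = q h x` becomes `(1 - q) h x = 0`, where `q ≠ 1` and `h` is a
unit. -/
theorem proj_map_x (hn : 1 < n) (hm : 1 < m) (hω' : ω' ^ n = 1)
    (e : TaftT n m q ω ≃ₐc[K] TaftT n m q ω') : proj n m q ω' (e (x n m q ω)) = 0 := by
  have hv := proj_eq_hBar hn hm hω' hq.out.pow_eq_one (isGroupLikeElem_h.map e) (comul_map_x e)
    (degOne_map_x_ne_zero hn hm hω' e)
  have h1 := congrArg (fun a => proj n m q ω' (e a)) (x_mul_h n m q ω)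
  simp only [map_mul, map_smul, hv] at h1
  have h2 : (1 - q) • (hBar K n m * proj n m q ω' (e (x n m q ω))) = 0 := by
    rw [sub_smul, one_smul, ← h1, mul_comm, sub_self]
  have h3 := (smul_eq_zero.mp h2).resolve_left (sub_ne_zero.mpr (hq.out.ne_one hm).symm)
  have hu : IsUnit (hBar K n m) := (Group.isUnit _).map (MonoidAlgebra.of K _)
  exact hu.mul_right_eq_zero.mp h3

/-- For `d = gcd(s, n)`, with `s` the first coordinate of `u`, reduce the group to `C_d` through
that coordinate. The images of `e g`, `e h`, `e x` become 1, 1, 0, so the composite with `e` is the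
counit. As `e` is onto, the generator of `C_d` is trivial and `d = 1`. -/
theorem coprime_of_proj_map_g (hn : 1 < n) (hm : 1 < m) (hω' : ω' ^ n = 1)
    (e : TaftT n m q ω ≃ₐc[K] TaftT n m q ω') {u : Grp n m}
    (hu : MonoidAlgebra.of K _ u = proj n m q ω' (e (g n m q ω))) :
    u.toAdd.1.val.Coprime n := by
  have hv := proj_eq_hBar hn hm hω' hq.out.pow_eq_one (isGroupLikeElem_h.map e) (comul_map_x e)
    (degOne_map_x_ne_zero hn hm hω' e)
  obtain ⟨d, hd⟩ : ∃ d, d = u.toAdd.1.val.gcd n := ⟨_, rfl⟩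
  have hdn : d ∣ n := hd ▸ Nat.gcd_dvd_right _ n
  have hdu : d ∣ u.toAdd.1.val := hd ▸ Nat.gcd_dvd_left _ n
  let c : Grp n m →* Multiplicative (ZMod d) := AddMonoidHom.toMultiplicative
    ((ZMod.castHom hdn (ZMod d)).toAddMonoidHom.comp (AddMonoidHom.fst _ _))
  have hc : ∀ w, c w = Multiplicative.ofAdd
      (ZMod.castHom hdn (ZMod d) w.toAdd.1) := fun _ => rfl
  have hcu : c u = 1 := by
    rw [hc, ← ofAdd_zero, ← ZMod.natCast_zmod_val u.toAdd.1, map_natCast]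
    exact congrArg _ ((ZMod.natCast_eq_zero_iff _ _).mpr hdu)
  let κ : GrpAlg K n m →ₐ[K] MonoidAlgebra K (Multiplicative (ZMod d)) :=
    MonoidAlgebra.mapDomainAlgHom K K c
  have hκ : ∀ w, κ (MonoidAlgebra.of K _ w) = MonoidAlgebra.of K _ (c w) := fun w => by
    simp [κ]
  have key : (κ.comp (proj n m q ω')).comp (e : _ →ₐ[K] TaftT n m q ω') =
      (Algebra.ofId K _).comp (counitHom n m q ω) := by
    apply algHom_ext
    · simp only [AlgHom.comp_apply, counitHom_g, map_one]
      refine (congrArg κ hu.symm).trans ?_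
      rw [hκ, hcu, map_one]
    · simp only [AlgHom.comp_apply, counitHom_h, map_one]
      refine (congrArg κ hv).trans ?_
      rw [hBar, hκ, hc]
      simp [← MonoidAlgebra.one_def]
    · simp only [AlgHom.comp_apply, counitHom_x, map_zero]
      exact (congrArg κ (proj_map_x hn hm hω' e)).trans (map_zero κ)
  -- Evaluating at the preimage of `g` is where surjectivity of `e` enters.
  have h1 := DFunLike.congr_fun key (e.symm (g n m q ω'))
  have h2 : counitHom n m q ω (e.symm (g n m q ω')) = 1 :=
    (isGroupLikeElem_g.map e.symm).counit_eq_one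
  simp only [AlgHom.comp_apply, h2, map_one] at h1
  have h3 : κ (gBar K n m) = 1 := by
    rw [← h1, ← proj_g n m q ω']
    exact congrArg (fun a => κ (proj n m q ω' a)) (BialgEquiv.apply_symm_apply e _).symm
  rw [gBar, hκ, ← map_one (MonoidAlgebra.of K (Multiplicative (ZMod d)))] at h3
  have h4 : (1 : ZMod d) = 0 := by
    have := MonoidAlgebra.of_injective h3
    rw [hc, ← ofAdd_zero] at this
    simpa only [toAdd_ofAdd, map_one] using Multiplicative.ofAdd.injective this
  rwa [← Nat.cast_one, ZMod.natCast_eq_zero_iff, Nat.dvd_one, hd] at h4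

/-- Applying `degOne ∘ e` to `g x = ω x g` leaves the same nonzero element on both sides, scaled by
the character of `u` and by `ω`. -/
theorem character_proj_map_g (hn : 1 < n) (hm : 1 < m) (hω' : ω' ^ n = 1)
    (e : TaftT n m q ω ≃ₐc[K] TaftT n m q ω') {u : Grp n m}
    (hu : MonoidAlgebra.of K _ u = proj n m q ω' (e (g n m q ω))) :
    character hω' hq.out.pow_eq_one u = ω := by
  have h1 := congrArg (fun a => degOne hm hω' hq.out.pow_eq_one (e a)) (g_mul_x n m q ω)
  simp only [map_mul, map_smul, degOne_mul _ _ _ hn, ← hu, twist_of,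
    degOne_eq_zero hn hm hω' _ (isGroupLikeElem_g.map e), zero_mul, add_zero, mul_zero,
    zero_add] at h1
  rw [smul_mul_assoc, mul_comm, ← sub_eq_zero, ← sub_smul, smul_eq_zero, sub_eq_zero] at h1
  refine h1.resolve_right fun h0 => degOne_map_x_ne_zero hn hm hω' e ?_
  exact ((Group.isUnit u).map (MonoidAlgebra.of K _)).mul_left_eq_zero.mp h0

theorem exists_of_bialgEquiv (hn : 1 < n) (hm : 1 < m) (hω' : ω' ^ n = 1)
    (e : TaftT n m q ω ≃ₐc[K] TaftT n m q ω') :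
    ∃ l < m, ∃ s < n, s.Coprime n ∧ ω' ^ s = q ^ l * ω := by
  obtain ⟨u, hu⟩ := exists_proj_eq_of (isGroupLikeElem_g.map e)
  -- The character has `q⁻¹` on the second coordinate, so that coordinate serves as `l` without a
  -- sign.
  refine ⟨u.toAdd.2.val, ZMod.val_lt _, u.toAdd.1.val, ZMod.val_lt _,
    coprime_of_proj_map_g hn hm hω' e hu, ?_⟩
  have hq0 : q ≠ 0 := hq.out.ne_zero (NeZero.ne m)
  rw [← character_proj_map_g hn hm hω' e hu]
  simp only [character, MonoidHom.coe_mk, OneHom.coe_mk, inv_pow]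
  field_simp

end isomorphism

/-! ### Isomorphisms from monomial substitutions -/

section monomialHom

variable {K : Type*} [Field K] {n m : ℕ} {q ω ω' : K}

theorem h_pow_eq_one {k : ℕ} (hk : m ∣ k) : h n m q ω ^ k = 1 := by
  obtain ⟨j, rfl⟩ := hk
  rw [pow_mul, h_pow, one_pow]

theorem g_pow_mul_x (s : ℕ) : g n m q ω ^ s * x n m q ω = ω ^ s • (x n m q ω * g n m q ω ^ s) := by
  induction s with
  | zero => simp
  | succ s ih =>
    rw [pow_succ, mul_assoc, g_mul_x, mul_smul_comm, ← mul_assoc, ih, smul_mul_assoc, smul_smul,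
      mul_assoc, pow_succ']

theorem monomial_pow (s l k : ℕ) :
    (g n m q ω ^ s * h n m q ω ^ l) ^ k = g n m q ω ^ (s * k) * h n m q ω ^ (l * k) := by
  rw [Commute.mul_pow (Commute.pow_pow (h_mul_g n m q ω).symm s l), pow_mul, pow_mul]

theorem monomial_mul_x (hq : q ≠ 0) {s l : ℕ} (hsl : ω' ^ s = q ^ l * ω) :
    g n m q ω' ^ s * h n m q ω' ^ l * x n m q ω' =
      ω • (x n m q ω' * (g n m q ω' ^ s * h n m q ω' ^ l)) := by
  have hx : h n m q ω' ^ l * x n m q ω' = (q ^ l)⁻¹ • (x n m q ω' * h n m q ω' ^ l) := by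
    rw [QBinomial.mul_pow_of_skew (x_mul_h n m q ω'), smul_smul,
      inv_mul_cancel₀ (pow_ne_zero l hq), one_smul]
  rw [mul_assoc, hx, mul_smul_comm, ← mul_assoc, g_pow_mul_x, hsl, smul_mul_assoc, smul_smul,
    inv_mul_cancel_left₀ (pow_ne_zero l hq), mul_assoc]

/-- The algebra map with `g ↦ g ^ s * h ^ l`, `h ↦ h`, `x ↦ x`. -/
def monomialHom (hq : q ≠ 0) {s l : ℕ} (hl : m ∣ l * n) (hsl : ω' ^ s = q ^ l * ω) :
    TaftT n m q ω →ₐ[K] TaftT n m q ω' :=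
  lift (g n m q ω' ^ s * h n m q ω' ^ l) (h n m q ω') (x n m q ω')
    (by rw [monomial_pow, h_pow_eq_one hl, mul_comm s n, pow_mul, g_pow, one_pow, one_mul])
    (h_pow n m q ω') (x_pow n m q ω') (x_mul_h n m q ω')
    (by
      have h1 : Commute (h n m q ω') (g n m q ω') := h_mul_g n m q ω'
      exact ((h1.pow_right s).mul_right ((Commute.refl _).pow_right l)).eq)
    (monomial_mul_x hq hsl)

section

variable (hq : q ≠ 0) {s l : ℕ} (hl : m ∣ l * n) (hsl : ω' ^ s = q ^ l * ω)

theorem monomialHom_g : monomialHom hq hl hsl (g n m q ω) = g n m q ω' ^ s * h n m q ω' ^ l := by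
  rw [monomialHom, lift_g]

theorem monomialHom_h : monomialHom hq hl hsl (h n m q ω) = h n m q ω' := by
  rw [monomialHom, lift_h]

theorem monomialHom_x : monomialHom hq hl hsl (x n m q ω) = x n m q ω' := by
  rw [monomialHom, lift_x]

/-- The composite sends `g` to `g ^ (s' * s) * h ^ (l' * s + l)`; the last two hypotheses reduce
this to `g`. -/
theorem monomialHom_comp {s' l' : ℕ} (hl' : m ∣ l' * n) (hsl' : ω ^ s' = q ^ l' * ω')
    (hs : g n m q ω ^ (s' * s) = g n m q ω) (hh : m ∣ l' * s + l) :
    (monomialHom hq hl' hsl').comp (monomialHom hq hl hsl) = .id K _ := by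
  apply algHom_ext
  · simp only [AlgHom.comp_apply, monomialHom_g, map_mul, map_pow, monomialHom_h, monomial_pow,
      mul_assoc, ← pow_add, h_pow_eq_one hh, hs, mul_one, AlgHom.id_apply]
  · simp [monomialHom_h]
  · simp [monomialHom_x]

end

variable [NeZero m] [Fact (IsPrimitiveRoot q m)]

theorem map_antipode [NeZero n] (e : TaftT n m q ω ≃ₐc[K] TaftT n m q ω')
    (hh : e (h n m q ω) = h n m q ω') (hx : e (x n m q ω) = x n m q ω') (a : TaftT n m q ω) :
    e (HopfAlgebra.antipode K a) = HopfAlgebra.antipode K (e a) := by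
  have hS : ∀ (θ : K) (b : TaftT n m q θ),
    HopfAlgebra.antipode K b = antipodeLin n m q θ b := fun _ _ => rfl
  have hG : ∀ b : TaftT n m q ω, IsGroupLikeElem K b →
      e (HopfAlgebra.antipode K b) = HopfAlgebra.antipode K (e b) := by
    intro b hb
    -- Both sides are inverses of the group-like `e b`.
    refine left_inv_eq_right_inv (a := e b) ?_ (hb.map e).mul_antipode_cancel
    rw [← map_mul, hb.antipode_mul_cancel, map_one]
  induction a using TaftT.induction with
  | hK r => simp [Algebra.algebraMap_eq_smul_one]
  | hg => exact hG _ isGroupLikeElem_g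
  | hh => exact hG _ isGroupLikeElem_h
  | hx => simp [hx, hS, antipodeLin_apply, antipodeHom_x, hh]
  | hmul a b ha hb =>
    simp only [hS] at ha hb ⊢
    rw [antipodeLin_mul, map_mul, map_mul, antipodeLin_mul, ha, hb]
  | hadd a b ha hb => simp [ha, hb]

theorem hopfIsomorphic_of_pow_eq [NeZero n] (hn : 1 < n) (hω : ω ^ n = 1) (hω' : ω' ^ n = 1)
    {s l : ℕ} (hs : s.Coprime n) (hsl : ω' ^ s = q ^ l * ω) :
    HopfIsomorphic K (TaftT n m q ω) (TaftT n m q ω') := by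
  have hq : IsPrimitiveRoot q m := Fact.out
  have hq0 : q ≠ 0 := hq.ne_zero (NeZero.ne m)
  -- The `n`-th power of `hsl` reads `1 = q ^ (l * n)`.
  have hl : m ∣ l * n := by
    rw [← hq.pow_eq_one_iff_dvd, pow_mul]
    have := congrArg (· ^ n) hsl
    simpa [mul_pow, hω, ← pow_mul, mul_comm s n, pow_mul ω', hω'] using this.symm
  obtain ⟨s', -, hs'⟩ := Nat.exists_mul_mod_eq_one_of_coprime hs hn
  obtain ⟨k, hss'⟩ : ∃ k, s * s' = 1 + n * k := ⟨s * s' / n, by rw [← hs', Nat.mod_add_div]⟩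
  have hpow : ∀ {M : Type _} [Monoid M] {a : M}, a ^ n = 1 → a ^ (s * s') = a := by
    intro M _ a ha
    rw [hss', pow_add, pow_mul, ha, one_pow, pow_one, mul_one]
  have hm1 : (m - 1) + 1 = m := Nat.sub_add_cancel NeZero.one_le
  -- The inverse uses the exponent `-l * s'` of `h`; the factor `m - 1` stands for `-1` modulo `m`.
  have hl' : m ∣ (m - 1) * (l * s') * n := by
    rw [show (m - 1) * (l * s') * n = l * n * ((m - 1) * s') by ring]
    exact hl.mul_right _
  have hsl' : ω ^ s' = q ^ ((m - 1) * (l * s')) * ω' := by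
    have h1 : ω' = q ^ (l * s') * ω ^ s' := by
      conv_lhs => rw [← hpow hω', pow_mul, hsl, mul_pow, ← pow_mul]
    conv_rhs => rw [h1, ← mul_assoc, ← pow_add, ← Nat.succ_mul, Nat.succ_eq_add_one, hm1, pow_mul,
      hq.pow_eq_one, one_pow, one_mul]
  have hd1 : m ∣ (m - 1) * (l * s') * s + l := by
    -- Since `s * s' = 1 + n * k`, the sum is a multiple of `m` plus a multiple of `l * n`.
    have h2 : (m - 1) * (l * s') * s + l = m * l + l * n * ((m - 1) * k) := by
      calc (m - 1) * (l * s') * s + l = (m - 1) * l * (s * s') + l := by ring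
        _ = (m - 1 + 1) * l + l * n * ((m - 1) * k) := by rw [hss']; ring
        _ = _ := by rw [hm1]
    rw [h2]
    exact (dvd_mul_right m l).add (hl.mul_right _)
  have hd2 : m ∣ l * s' + (m - 1) * (l * s') := by
    rw [add_comm, ← Nat.succ_mul, Nat.succ_eq_add_one, hm1]
    exact dvd_mul_right _ _
  let f := monomialHom hq0 hl hsl
  let f' := monomialHom hq0 hl' hsl'
  let e : TaftT n m q ω ≃ₐ[K] TaftT n m q ω' := .ofAlgHom f f'
    (monomialHom_comp hq0 hl' hsl' hl hsl (hpow (g_pow n m q ω')) hd2)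
    (monomialHom_comp hq0 hl hsl hl' hsl'
      ((congrArg _ (mul_comm s' s)).trans (hpow (g_pow n m q ω))) hd1)
  have hg : e (g n m q ω) = g n m q ω' ^ s * h n m q ω' ^ l := monomialHom_g hq0 hl hsl
  have hh : e (h n m q ω) = h n m q ω' := monomialHom_h hq0 hl hsl
  have hx : e (x n m q ω) = x n m q ω' := monomialHom_x hq0 hl hsl
  refine ⟨.ofAlgEquiv e ?_ ?_, map_antipode _ hh hx⟩
  · apply algHom_ext
    · simp [hg, counit_eq, counitHom_g, counitHom_h]
    · simp [hh, counit_eq, counitHom_h]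
    · simp [hx, counit_eq, counitHom_x]
  · apply algHom_ext
    · simp [hg, comul_eq, comulHom_g, comulHom_h]
    · simp [hh, comul_eq, comulHom_h]
    · simp [hx, hh, comul_eq, comulHom_x]

end monomialHom

end

end TaftT

theorem theorem3p4 {K : Type*} [Field K] (n m : ℕ) [NeZero n] [NeZero m]
    (hn : 2 ≤ n) (hm : 3 ≤ m) (q : K) [Fact (IsPrimitiveRoot q m)]
    (ξ : Kˣ) (hξ : Subgroup.zpowers ξ = rootsOfUnity n K)
    (t t' : ℕ) (ht : t < Nat.card (rootsOfUnity n K)) (ht' : t' < Nat.card (rootsOfUnity n K)) :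
    HopfIsomorphic K (TaftT n m q (ξ ^ t : K)) (TaftT n m q (ξ ^ t' : K)) ↔
      ∃ l < m, ∃ s < n, Nat.Coprime s n ∧ (ξ : K) ^ ((s : ℤ) * t' - t) = q ^ l := by
  have hξn : (ξ : K) ^ n = 1 := by
    have h1 : ξ ∈ rootsOfUnity n K := hξ ▸ Subgroup.mem_zpowers ξ
    simpa using congrArg Units.val ((mem_rootsOfUnity n ξ).mp h1)
  have hpow (k : ℕ) : ((ξ : K) ^ k) ^ n = 1 := by rw [pow_right_comm, hξn, one_pow]
  -- Clearing the possibly negative exponent gives the form used by both directions.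
  have hiff (s l : ℕ) : (ξ : K) ^ ((s : ℤ) * t' - t) = q ^ l ↔
      ((ξ : K) ^ t') ^ s = q ^ l * (ξ : K) ^ t := by
    rw [zpow_sub₀ ξ.ne_zero, div_eq_iff (zpow_ne_zero _ ξ.ne_zero), ← pow_mul, mul_comm t' s,
      zpow_natCast, ← Nat.cast_mul, zpow_natCast]
  simp only [hiff]
  constructor
  · rintro ⟨e, -⟩
    exact TaftT.exists_of_bialgEquiv (by omega) (by omega) (hpow t') e
  · rintro ⟨l, -, s, -, hs, hsl⟩
    exact TaftT.hopfIsomorphic_of_pow_eq (by omega) (hpow t) (hpow t') hs hsl
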